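/- For $n\ge 0$ let $\mathfrak D_n$ be the set of derangements of $\{1,\dots,n\}$ (permutations without fixed points) and $$B_n(y,q)=\sum_{\sigma\in\mathfrak D_n}y^{\mathrm{wex}(\sigma)}q^{\mathrm{cr}(\sigma)},$$ where $\mathrm{wex}(\sigma)$ is the number of $i$ with $\sigma(i)\ge i$, and $\mathrm{cr}(\sigma)$ is the number of pairs $(i,j)$ such that $i<j\le\sigma(i)<\sigma(j)$ or $\sigma(i)<\sigma(j)<i<j$. Let $R$ be a commutative ring and let $y,q\in R$. (1) (Matrix Ansatz.) Let $D,E$ be matrices with entries in $R$, indexed by an arbitrary (possibly infinite) set, $\langle W|$ a row vector and $|V\rangle$ a column vector over $R$ such that $$DE-qED=I+qE+D,\qquad \langle W|E=0,\qquad D|V\rangle=0,\qquad \langle W|V\rangle=1. \qquad(*)$$ Suppose that the sums in matrix products are finite, in the sense that either the rows of $D$ and $E$ and the vector $\langle W|$ have finite support, or the columns of $D$ and $E$ and the vector $|V\rangle$ have finite support. Then for every $n\ge 0$ $$\langle W|(yD+E)^n|V\rangle=B_n(y,q).$$ The same holds if $D,E$ are endomorphisms of an arbitrary $R$-module $M$,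 $|V\rangle\in M$, and $\langle W|$ is an $R$-linear form on $M$, such that $(*)$ holds. (2) (Normal ordering.) In the unital associative $R$-algebra generated by $D$ and $E$ subject to the single relation $DE-qED=1+qE+D$, for every $n\ge 0$ the element $(yD+E)^n$ can be written in a unique way as a finite linear combination $\sum_{i,j\ge 0}c_{ij}E^iD^j$ with $c_{ij}\in R$, and its constant term is $c_{00}=B_n(y,q)$. -/

import Mathlib

universe u v w

namespace DerangementAnsatz

/-! Permutation statistics. Permutations of `{1, …, n}` are permutations of `Fin n`;
shifting the labels by one does not affect the statistics. -/

/-- The number of weak exceedances: indices `i` with `σ(i) ≥ i`. -/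
def wex {n : ℕ} (σ : Equiv.Perm (Fin n)) : ℕ :=
  (Finset.univ.filter fun i : Fin n => i ≤ σ i).card

/-- The number of crossings: pairs `(i, j)` with `i < j ≤ σ(i) < σ(j)`
or `σ(i) < σ(j) < i < j`. -/
def cr {n : ℕ} (σ : Equiv.Perm (Fin n)) : ℕ :=
  (Finset.univ.filter fun p : Fin n × Fin n =>
    (p.1 < p.2 ∧ p.2 ≤ σ p.1 ∧ σ p.1 < σ p.2) ∨
    (σ p.1 < σ p.2 ∧ σ p.2 < p.1 ∧ p.1 < p.2)).card

/-- `B_n(y, q)`, the sum of `y ^ wex(σ) * q ^ cr(σ)` over the derangements `σ` of `n` points. -/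
def B {R : Type u} [CommRing R] (n : ℕ) (y q : R) : R :=
  ∑ σ : derangements (Fin n), y ^ wex σ.1 * q ^ cr σ.1

/-! Matrices with a possibly infinite index set. Every sum written below with `∑ᶠ` has only
finitely many nonzero terms when the matrices are row-finite and row vectors have finite support,
and also when the matrices are column-finite and column vectors have finite support. -/

section InfiniteMatrices

variable {R : Type u} [CommRing R] {ι : Type v}

/-- Every row has finite support. -/
def RowFinite (A : Matrix ι ι R) : Prop := ∀ i, (Function.support fun j => A i j).Finite

/-- Every column has finite support. -/
def ColFinite (A : Matrix ι ι R) : Prop := ∀ j, (Function.support fun i => A i j).Finite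

/-- The product of two matrices. -/
noncomputable def mMul (A B : Matrix ι ι R) : Matrix ι ι R :=
  Matrix.of fun i j => ∑ᶠ k, A i k * B k j

/-- The powers of a matrix. -/
noncomputable def mPow [DecidableEq ι] (A : Matrix ι ι R) : ℕ → Matrix ι ι R
  | 0 => 1
  | n + 1 => mMul (mPow A n) A

/-- The row vector `⟨W|A`. -/
noncomputable def rowMul (W : ι → R) (A : Matrix ι ι R) : ι → R :=
  fun j => ∑ᶠ i, W i * A i j

/-- The column vector `A|V⟩`. -/
noncomputable def mulCol (A : Matrix ι ι R) (V : ι → R) : ι → R :=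
  fun i => ∑ᶠ j, A i j * V j

/-- The scalar `⟨W|V⟩`. -/
noncomputable def braket (W V : ι → R) : R := ∑ᶠ i, W i * V i

/-- All products of the matrices `D`, `E`, the row vector `W` and the column vector `V`
are finite sums. -/
def FiniteSums (D E : Matrix ι ι R) (W V : ι → R) : Prop :=
  (RowFinite D ∧ RowFinite E ∧ (Function.support W).Finite) ∨
  (ColFinite D ∧ ColFinite E ∧ (Function.support V).Finite)

/-- The relations `DE - qED = I + qE + D`, `⟨W|E = 0`, `D|V⟩ = 0`, `⟨W|V⟩ = 1`
for matrices and vectors. -/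
structure MatrixAnsatz [DecidableEq ι] (q : R) (D E : Matrix ι ι R) (W V : ι → R) : Prop where
  comm : mMul D E - q • mMul E D = 1 + q • E + D
  left : rowMul W E = 0
  right : mulCol D V = 0
  norm : braket W V = 1

end InfiniteMatrices

/-- The same relations for endomorphisms `D`, `E` of an arbitrary module, a linear form `W`
and a vector `V`. -/
structure OperatorAnsatz {R : Type u} [CommRing R] {M : Type w} [AddCommGroup M] [Module R M]
    (q : R) (D E : Module.End R M) (W : Module.Dual R M) (V : M) : Prop where
  comm : D * E - q • (E * D) = 1 + q • E + D
  left : W ∘ₗ E = 0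
  right : D V = 0
  norm : W V = 1

/-! Normal ordering: the algebra generated by two letters `D`, `E` subject to
`DE - qED = 1 + qE + D` only. -/

/-- The two letters. -/
inductive Letter
  | D
  | E

section NormalOrdering

variable {R : Type u} [CommRing R]

/-- The defining relation `DE - qED = 1 + qE + D`. -/
inductive Rel (q : R) : FreeAlgebra R Letter → FreeAlgebra R Letter → Prop
  | comm : Rel q
      (FreeAlgebra.ι R Letter.D * FreeAlgebra.ι R Letter.E
        - q • (FreeAlgebra.ι R Letter.E * FreeAlgebra.ι R Letter.D))
      (1 + q • FreeAlgebra.ι R Letter.E + FreeAlgebra.ι R Letter.D)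

/-- The algebra presented by the generators `D`, `E` and the relation above. -/
abbrev Alg (q : R) : Type u := RingQuot (Rel q)

/-- The generator `D`. -/
noncomputable def genD (q : R) : Alg q :=
  RingQuot.mkAlgHom R (Rel q) (FreeAlgebra.ι R Letter.D)

/-- The generator `E`. -/
noncomputable def genE (q : R) : Alg q :=
  RingQuot.mkAlgHom R (Rel q) (FreeAlgebra.ι R Letter.E)

/-- `c` is a (finitely supported) family of coefficients of a normal-ordered expansion
`x = ∑ c_{ij} E^i D^j`. -/
def IsNormalOrder (q : R) (x : Alg q) (c : ℕ × ℕ →₀ R) : Prop :=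
  x = c.sum fun ij a => a • (genE q ^ ij.1 * genD q ^ ij.2)

end NormalOrdering

end DerangementAnsatz

open DerangementAnsatz

/-! The relation reads `D E = (q E + 1) (D + 1)`, which determines how `D` acts from the left on
the monomials `E ^ i * D ^ j`. These formulas define a module with basis indexed by `(i, j)` on
which the presented algebra acts, so the monomials are linearly independent and the constant term
of `x` is the value `⟨W|x|V⟩` for *every* solution of the Ansatz. Infinite matrices are no
exception: a row-finite matrix is an endomorphism of the finitely supported row vectors, and acts
on their dual; a column-finite one acts on the finitely supported column vectors.

It remains to evaluate one solution. If `δ X = q X δ + 1`, then `E = X (1 + δ)` and `D = δ E - 1`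
satisfy the relation; take `X` to be multiplication and `δ` the `q`-derivative on polynomials.
Then `y D + E = (1 + y δ) E - y`. Place non-attacking rooks off the diagonal of an `n × n` board
and let the power of `X` record the number of empty rows. Adding a row to the board applies `E`,
where the coefficient `1 + q + ⋯ + q ^ (h - 1)` of `δ X ^ h` sums over the possible positions of a
rook in the new row; adding a column applies `1 + y δ`, and `-y` takes back the diagonal cell.
Thus `(y D + E) ^ n` applied to `1` is the weighted sum over all placements, and its constant
coefficient comes from the placements without empty rows, which are the graphs of derangements.
-/

namespace DerangementAnsatz

section Presentation

variable {R : Type u} [CommRing R] {q : R} {A : Type*} [Ring A] [Algebra R A]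

theorem ansatz_relation_iff {D E : A} :
    D * E - q • (E * D) = 1 + q • E + D ↔ D * E = (q • E + 1) * (D + 1) := by
  rw [sub_eq_iff_eq_add]
  simp only [add_mul, mul_add, one_mul, mul_one, smul_mul_assoc]
  exact Eq.congr_right (by abel)

theorem genD_mul_genE (q : R) : genD q * genE q = (q • genE q + 1) * (genD q + 1) := by
  have hrel := RingQuot.mkAlgHom_rel R (Rel.comm (q := q))
  simp only [map_sub, map_mul, map_smul, map_add, map_one] at hrel
  exact ansatz_relation_iff.mp hrel

@[elab_as_elim]
theorem alg_induction {p : Alg q → Prop} (algebraMap : ∀ r : R, p (algebraMap R (Alg q) r))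
    (genD : p (genD q)) (genE : p (genE q)) (mul : ∀ a b, p a → p b → p (a * b))
    (add : ∀ a b, p a → p b → p (a + b)) (x : Alg q) : p x := by
  obtain ⟨a, rfl⟩ := RingQuot.mkAlgHom_surjective R (Rel q) x
  induction a using FreeAlgebra.induction with
  | grade0 r => exact (AlgHom.commutes (RingQuot.mkAlgHom R (Rel q)) r).symm ▸ algebraMap r
  | grade1 l => exact Letter.rec genD genE l
  | mul a b ha hb => exact (map_mul (RingQuot.mkAlgHom R (Rel q)) a b).symm ▸ mul _ _ ha hb
  | add a b ha hb => exact (map_add (RingQuot.mkAlgHom R (Rel q)) a b).symm ▸ add _ _ ha hb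

/-- The universal property of `Alg q`: the homomorphism sending the generators to two given
elements `D`, `E` that satisfy the relation. -/
noncomputable def rep (D E : A) (h : D * E - q • (E * D) = 1 + q • E + D) : Alg q →ₐ[R] A :=
  RingQuot.liftAlgHom R ⟨FreeAlgebra.lift R (Letter.rec D E), by
    rintro _ _ ⟨⟩
    simpa using h⟩

variable {D E : A} (h : D * E - q • (E * D) = 1 + q • E + D)

@[simp]
theorem rep_genD : rep D E h (genD q) = D := by
  simp [rep, genD]

@[simp]
theorem rep_genE : rep D E h (genE q) = E := by
  simp [rep, genE]

theorem rep_pow (y : R) (n : ℕ) : rep D E h ((y • genD q + genE q) ^ n) = (y • D + E) ^ n := by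
  simp

end Presentation

section NormalForm

variable {R : Type u} [CommRing R] {q : R}

variable (R) in
/-- Left multiplication by `E` in the normal-ordered basis, where `single (i, j) 1` stands for
`E ^ i * D ^ j`. -/
noncomputable def mulE : Module.End R (ℕ × ℕ →₀ R) :=
  Finsupp.lmapDomain R R (Prod.map Nat.succ id)

/-- The normal-ordered expansion of `D * E ^ i * D ^ j`; the recursion is the commutation relation
in the form `D * E = (q • E + 1) * (D + 1)`. -/
noncomputable def mulDBasis (q : R) : ℕ → ℕ → (ℕ × ℕ →₀ R)
  | 0, j => Finsupp.single (0, j + 1) 1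
  | i + 1, j => (q • mulE R + 1) (mulDBasis q i j + Finsupp.single (i, j) 1)

/-- Left multiplication by `D` in the normal-ordered basis. -/
noncomputable def mulD (q : R) : Module.End R (ℕ × ℕ →₀ R) :=
  Finsupp.linearCombination R fun ij : ℕ × ℕ => mulDBasis q ij.1 ij.2

theorem mulE_single (i j : ℕ) :
    mulE R (Finsupp.single (i, j) 1) = Finsupp.single (i + 1, j) 1 := by
  simp [mulE, Finsupp.mapDomain_single]

theorem mulD_single (q : R) (i j : ℕ) : mulD q (Finsupp.single (i, j) 1) = mulDBasis q i j := by
  simp [mulD]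

theorem mulD_single_succ (q : R) (i j : ℕ) :
    mulD q (Finsupp.single (i + 1, j) 1)
      = (q • mulE R + 1) (mulD q (Finsupp.single (i, j) 1) + Finsupp.single (i, j) 1) := by
  rw [mulD_single, mulD_single, mulDBasis]

theorem mulD_mulE_relation (q : R) :
    mulD q * mulE R - q • (mulE R * mulD q) = 1 + q • mulE R + mulD q := by
  apply (ansatz_relation_iff (A := Module.End R (ℕ × ℕ →₀ R))).mpr
  refine Finsupp.lhom_ext' fun ⟨i, j⟩ => LinearMap.ext_ring ?_
  change mulD q (mulE R (Finsupp.single (i, j) 1)) = _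
  rw [mulE_single]
  exact mulD_single_succ q i j

theorem mulE_pow_mulD_pow_single (q : R) (i j : ℕ) :
    (mulE R ^ i * mulD q ^ j) (Finsupp.single (0, 0) 1) = Finsupp.single (i, j) 1 := by
  have hD : (mulD q ^ j) (Finsupp.single (0, 0) 1) = Finsupp.single (0, j) 1 := by
    induction j with
    | zero => simp
    | succ j ih => rw [pow_succ', Module.End.mul_apply, ih, mulD_single, mulDBasis]
  rw [Module.End.mul_apply, hD]
  induction i with
  | zero => simp
  | succ i ih => rw [pow_succ', Module.End.mul_apply, ih, mulE_single]

/-- The element of `Alg q` with a given family of normal-ordered coefficients. -/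
noncomputable def ofCoeffs (q : R) : (ℕ × ℕ →₀ R) →ₗ[R] Alg q :=
  Finsupp.linearCombination R fun ij => genE q ^ ij.1 * genD q ^ ij.2

theorem isNormalOrder_iff_eq_ofCoeffs {x : Alg q} {c : ℕ × ℕ →₀ R} :
    IsNormalOrder q x c ↔ x = ofCoeffs q c :=
  Iff.rfl

theorem ofCoeffs_single (i j : ℕ) :
    ofCoeffs q (Finsupp.single (i, j) 1) = genE q ^ i * genD q ^ j := by
  simp [ofCoeffs]

theorem ofCoeffs_mulE (v : ℕ × ℕ →₀ R) : ofCoeffs q (mulE R v) = genE q * ofCoeffs q v := by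
  suffices ofCoeffs q ∘ₗ mulE R = LinearMap.mulLeft R (genE q) ∘ₗ ofCoeffs q from
    LinearMap.congr_fun this v
  refine Finsupp.lhom_ext' fun ⟨i, j⟩ => LinearMap.ext_ring ?_
  simp only [LinearMap.comp_apply, Finsupp.lsingle_apply, LinearMap.mulLeft_apply, mulE_single,
    ofCoeffs_single, pow_succ', mul_assoc]

theorem ofCoeffs_mulD_single (i j : ℕ) :
    ofCoeffs q (mulD q (Finsupp.single (i, j) 1)) = genD q * (genE q ^ i * genD q ^ j) := by
  induction i with
  | zero => simp only [mulD_single, mulDBasis, ofCoeffs_single, pow_zero, one_mul, pow_succ']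
  | succ i ih =>
    calc ofCoeffs q (mulD q (Finsupp.single (i + 1, j) 1))
        = (q • genE q + 1) * (genD q * (genE q ^ i * genD q ^ j) + genE q ^ i * genD q ^ j) := by
          rw [mulD_single_succ, LinearMap.add_apply, LinearMap.smul_apply, Module.End.one_apply,
            map_add, map_smul, ofCoeffs_mulE, map_add, ih, ofCoeffs_single, add_mul,
            smul_mul_assoc, one_mul]
      _ = genD q * genE q * (genE q ^ i * genD q ^ j) := by
          rw [genD_mul_genE, mul_assoc, add_mul (genD q), one_mul]
      _ = genD q * (genE q ^ (i + 1) * genD q ^ j) := by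
          simp only [pow_succ', mul_assoc]

theorem ofCoeffs_mulD (v : ℕ × ℕ →₀ R) : ofCoeffs q (mulD q v) = genD q * ofCoeffs q v := by
  suffices ofCoeffs q ∘ₗ mulD q = LinearMap.mulLeft R (genD q) ∘ₗ ofCoeffs q from
    LinearMap.congr_fun this v
  refine Finsupp.lhom_ext' fun ⟨i, j⟩ => LinearMap.ext_ring ?_
  simpa [ofCoeffs_single] using ofCoeffs_mulD_single (q := q) i j

theorem ofCoeffs_rep (x : Alg q) (v : ℕ × ℕ →₀ R) :
    ofCoeffs q (rep (mulD q) (mulE R) (mulD_mulE_relation q) x v) = x * ofCoeffs q v := by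
  induction x using alg_induction generalizing v with
  | algebraMap r => rw [AlgHom.commutes, Module.algebraMap_end_apply, map_smul, Algebra.smul_def]
  | genD => rw [rep_genD, ofCoeffs_mulD]
  | genE => rw [rep_genE, ofCoeffs_mulE]
  | mul a b ha hb => rw [map_mul, Module.End.mul_apply, ha, hb, mul_assoc]
  | add a b ha hb => rw [map_add, LinearMap.add_apply, map_add, ha, hb, add_mul]

/-- The coefficients of the normal-ordered expansion of an element of `Alg q`, obtained by letting
it act on the basis vector that stands for `1`. -/
noncomputable def normalCoeffs (q : R) : Alg q →ₗ[R] (ℕ × ℕ →₀ R) :=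
  LinearMap.applyₗ (Finsupp.single (0, 0) 1) ∘ₗ
    (rep (mulD q) (mulE R) (mulD_mulE_relation q)).toLinearMap

theorem ofCoeffs_normalCoeffs (x : Alg q) : ofCoeffs q (normalCoeffs q x) = x := by
  change ofCoeffs q (rep (mulD q) (mulE R) _ x (Finsupp.single (0, 0) 1)) = x
  rw [ofCoeffs_rep, ofCoeffs_single, pow_zero, pow_zero, mul_one, mul_one]

theorem normalCoeffs_ofCoeffs (c : ℕ × ℕ →₀ R) : normalCoeffs q (ofCoeffs q c) = c := by
  suffices normalCoeffs q ∘ₗ ofCoeffs q = LinearMap.id from LinearMap.congr_fun this c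
  refine Finsupp.lhom_ext' fun ⟨i, j⟩ => LinearMap.ext_ring ?_
  change rep (mulD q) (mulE R) _ (ofCoeffs q (Finsupp.single (i, j) 1)) _ = Finsupp.single (i, j) 1
  rw [ofCoeffs_single, map_mul, map_pow, map_pow, rep_genE, rep_genD, mulE_pow_mulD_pow_single]

theorem isNormalOrder_iff {x : Alg q} {c : ℕ × ℕ →₀ R} :
    IsNormalOrder q x c ↔ c = normalCoeffs q x := by
  rw [isNormalOrder_iff_eq_ofCoeffs]
  constructor
  · rintro rfl
    exact (normalCoeffs_ofCoeffs c).symm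
  · rintro rfl
    exact (ofCoeffs_normalCoeffs x).symm

theorem existsUnique_isNormalOrder (x : Alg q) : ∃! c, IsNormalOrder q x c := by
  simp only [isNormalOrder_iff, existsUnique_eq]

end NormalForm

section Operators

variable {R : Type u} [CommRing R] {q : R} {M : Type*} [AddCommGroup M] [Module R M]
  {D E : Module.End R M} {W : Module.Dual R M} {V : M}

theorem OperatorAnsatz.apply_monomial (h : OperatorAnsatz q D E W V) (i j : ℕ) :
    W ((E ^ i * D ^ j) V) = Finsupp.single (i, j) (1 : R) (0, 0) := by
  have hWE (v : M) : W (E v) = 0 := LinearMap.congr_fun h.left v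
  rcases i with _ | i
  · rcases j with _ | j
    · simpa using h.norm
    · simp [pow_succ, h.right]
  · simp [pow_succ', hWE]

theorem OperatorAnsatz.apply_rep (h : OperatorAnsatz q D E W V) (x : Alg q) :
    W (rep D E h.comm x V) = normalCoeffs q x (0, 0) := by
  suffices W ∘ₗ LinearMap.applyₗ V ∘ₗ (rep D E h.comm).toLinearMap ∘ₗ ofCoeffs q
      = Finsupp.lapply (0, 0) by
    simpa [ofCoeffs_normalCoeffs] using LinearMap.congr_fun this (normalCoeffs q x)
  refine Finsupp.lhom_ext' fun ⟨i, j⟩ => LinearMap.ext_ring ?_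
  change W (rep D E h.comm (ofCoeffs q (Finsupp.single (i, j) 1)) V) = _
  rw [ofCoeffs_single, map_mul, map_pow, map_pow, rep_genE, rep_genD, h.apply_monomial]
  rfl

end Operators

section RowMatrix

variable {R : Type u} [CommRing R] {ι : Type v}

/-- The row-finite matrix of an endomorphism `f` of the module of finitely supported row vectors:
its `i`-th row is `f` of the `i`-th unit vector. Since `f` stands for `w ↦ w * rowMatrix f`,
composition becomes multiplication in the opposite order. -/
noncomputable def rowMatrix (f : Module.End R (ι →₀ R)) : Matrix ι ι R :=
  Matrix.of fun i j => f (Finsupp.single i 1) j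

theorem rowMatrix_injective : Function.Injective (rowMatrix : Module.End R (ι →₀ R) → _) := by
  intro f g hfg
  refine Finsupp.lhom_ext' fun i => LinearMap.ext_ring (Finsupp.ext fun j => ?_)
  exact congrFun (congrFun hfg i) j

theorem RowFinite.exists_rowMatrix_eq {A : Matrix ι ι R} (hA : RowFinite A) :
    ∃ f, rowMatrix f = A := by
  refine ⟨Finsupp.linearCombination R fun i => Finsupp.ofSupportFinite (A i) (hA i), ?_⟩
  ext i j
  simp [rowMatrix, Finsupp.ofSupportFinite_coe]

theorem rowMatrix_add (f g : Module.End R (ι →₀ R)) :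
    rowMatrix (f + g) = rowMatrix f + rowMatrix g :=
  rfl

theorem rowMatrix_smul (r : R) (f : Module.End R (ι →₀ R)) :
    rowMatrix (r • f) = r • rowMatrix f :=
  rfl

theorem rowMatrix_sub (f g : Module.End R (ι →₀ R)) :
    rowMatrix (f - g) = rowMatrix f - rowMatrix g :=
  rfl

theorem rowMatrix_one [DecidableEq ι] : rowMatrix (1 : Module.End R (ι →₀ R)) = 1 := by
  ext i j
  simp [rowMatrix, Matrix.one_apply, Finsupp.single_apply]

theorem braket_coe (w : ι →₀ R) (v : ι → R) :
    braket w v = Finsupp.linearCombination R v w := by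
  rw [Finsupp.linearCombination_apply, Finsupp.sum]
  refine finsum_eq_sum_of_support_subset _ fun i hi => ?_
  exact Finsupp.mem_support_iff.mpr (left_ne_zero_of_mul hi)

theorem braket_comm (w v : ι → R) : braket w v = braket v w :=
  finsum_congr fun i => mul_comm (w i) (v i)

theorem rowMul_rowMatrix (w : ι →₀ R) (f : Module.End R (ι →₀ R)) :
    rowMul w (rowMatrix f) = f w := by
  funext j
  calc rowMul w (rowMatrix f) j
      = Finsupp.linearCombination R (fun i => f (Finsupp.single i 1) j) w := braket_coe w _
    _ = (Finsupp.lapply j ∘ₗ f) w := by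
        congr 1
        exact Finsupp.lhom_ext' fun i => LinearMap.ext_ring (by simp)
    _ = f w j := rfl

theorem mMul_rowMatrix (f g : Module.End R (ι →₀ R)) :
    mMul (rowMatrix f) (rowMatrix g) = rowMatrix (g * f) := by
  ext i j
  exact congrFun (rowMul_rowMatrix (f (Finsupp.single i 1)) g) j

theorem mPow_rowMatrix [DecidableEq ι] (f : Module.End R (ι →₀ R)) (n : ℕ) :
    mPow (rowMatrix f) n = rowMatrix (f ^ n) := by
  induction n with
  | zero => exact rowMatrix_one.symm
  | succ n ih => rw [mPow, ih, mMul_rowMatrix, pow_succ']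

theorem linearCombination_mulCol_rowMatrix (f : Module.End R (ι →₀ R)) (v : ι → R) :
    Finsupp.linearCombination R (mulCol (rowMatrix f) v) = Finsupp.linearCombination R v ∘ₗ f := by
  refine Finsupp.lhom_ext' fun i => LinearMap.ext_ring ?_
  change Finsupp.linearCombination R _ (Finsupp.single i 1) = _
  rw [Finsupp.linearCombination_single, one_smul]
  exact braket_coe (f (Finsupp.single i 1)) v

theorem transpose_mMul (A B : Matrix ι ι R) :
    (mMul A B).transpose = mMul B.transpose A.transpose := by
  ext i j
  exact braket_comm _ _

theorem transpose_mPow [DecidableEq ι] {A : Matrix ι ι R} {f : Module.End R (ι →₀ R)}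
    (h : rowMatrix f = A.transpose) (n : ℕ) : (mPow A n).transpose = rowMatrix (f ^ n) := by
  induction n with
  | zero => rw [mPow, Matrix.transpose_one, pow_zero, rowMatrix_one]
  | succ n ih => rw [mPow, transpose_mMul, ih, ← h, mMul_rowMatrix, pow_succ]

theorem mulCol_eq_rowMul_transpose (A : Matrix ι ι R) (v : ι → R) :
    mulCol A v = rowMul v A.transpose :=
  funext fun _ => braket_comm _ _

theorem rowMul_eq_mulCol_transpose (w : ι → R) (A : Matrix ι ι R) :
    rowMul w A = mulCol A.transpose w :=
  funext fun _ => braket_comm _ _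

end RowMatrix

section MatrixToOperator

theorem dualMap_pow {R : Type u} [CommRing R] {M : Type*} [AddCommGroup M] [Module R M]
    (f : Module.End R M) (n : ℕ) : (f ^ n).dualMap = f.dualMap ^ n := by
  induction n with
  | zero => rfl
  | succ n ih => rw [pow_succ', pow_succ, ← ih]; rfl

variable {R : Type u} [CommRing R] {ι : Type v} [DecidableEq ι] {q : R} {D E : Matrix ι ι R}
  {W V : ι → R}

theorem MatrixAnsatz.operatorAnsatz_of_row {d e : Module.End R (ι →₀ R)} {w : ι →₀ R}
    (h : MatrixAnsatz q (rowMatrix d) (rowMatrix e) w V) :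
    OperatorAnsatz q d.dualMap e.dualMap (Module.Dual.eval R _ w)
      (Finsupp.linearCombination R V) where
  comm := by
    have hcomm := h.comm
    rw [mMul_rowMatrix, mMul_rowMatrix, ← rowMatrix_one, ← rowMatrix_smul, ← rowMatrix_smul,
      ← rowMatrix_sub, ← rowMatrix_add, ← rowMatrix_add] at hcomm
    refine LinearMap.ext fun φ => LinearMap.ext fun v => ?_
    simpa using congrArg φ (LinearMap.congr_fun (rowMatrix_injective hcomm) v)
  left := by
    have he : e w = 0 := DFunLike.coe_injective ((rowMul_rowMatrix w e).symm.trans h.left)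
    ext φ
    simp [he]
  right := by
    change Finsupp.linearCombination R V ∘ₗ d = 0
    rw [← linearCombination_mulCol_rowMatrix, h.right]
    simp
  norm := (braket_coe w V).symm.trans h.norm

theorem MatrixAnsatz.operatorAnsatz_of_col {d e : Module.End R (ι →₀ R)} {v : ι →₀ R}
    (h : MatrixAnsatz q D E W v) (hd : rowMatrix d = D.transpose)
    (he : rowMatrix e = E.transpose) :
    OperatorAnsatz q d e (Finsupp.linearCombination R W) v where
  comm := by
    apply rowMatrix_injective
    have hcomm := congrArg Matrix.transpose h.comm
    simp only [Matrix.transpose_sub, Matrix.transpose_add, Matrix.transpose_smul,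
      Matrix.transpose_one, transpose_mMul, ← hd, ← he, mMul_rowMatrix] at hcomm
    rw [← rowMatrix_one] at hcomm
    exact hcomm
  left := by
    rw [← linearCombination_mulCol_rowMatrix, he, ← rowMul_eq_mulCol_transpose, h.left]
    simp
  right := by
    apply DFunLike.coe_injective
    rw [← rowMul_rowMatrix, hd, ← mulCol_eq_rowMul_transpose, h.right]
    rfl
  norm := by rw [← braket_coe, braket_comm v W, h.norm]

theorem MatrixAnsatz.braket_mPow_of_row {d e : Module.End R (ι →₀ R)} {w : ι →₀ R}
    (h : MatrixAnsatz q (rowMatrix d) (rowMatrix e) w V) (y : R) (n : ℕ) :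
    braket w (mulCol (mPow (y • rowMatrix d + rowMatrix e) n) V)
      = normalCoeffs q ((y • genD q + genE q) ^ n) (0, 0) := by
  rw [← h.operatorAnsatz_of_row.apply_rep, rep_pow, ← rowMatrix_smul, ← rowMatrix_add,
    mPow_rowMatrix, braket_coe, linearCombination_mulCol_rowMatrix]
  have hdual : y • d.dualMap + e.dualMap = (y • d + e).dualMap := by
    refine LinearMap.ext fun φ => LinearMap.ext fun v => ?_
    simp
  rw [hdual, ← dualMap_pow]
  rfl

theorem MatrixAnsatz.braket_mPow_of_col {d e : Module.End R (ι →₀ R)} {v : ι →₀ R}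
    (h : MatrixAnsatz q D E W v) (hd : rowMatrix d = D.transpose)
    (he : rowMatrix e = E.transpose) (y : R) (n : ℕ) :
    braket W (mulCol (mPow (y • D + E) n) v)
      = normalCoeffs q ((y • genD q + genE q) ^ n) (0, 0) := by
  have htranspose : rowMatrix (y • d + e) = (y • D + E).transpose := by
    rw [rowMatrix_add, rowMatrix_smul, hd, he, Matrix.transpose_add, Matrix.transpose_smul]
  rw [← (h.operatorAnsatz_of_col hd he).apply_rep, rep_pow, mulCol_eq_rowMul_transpose,
    transpose_mPow htranspose, rowMul_rowMatrix, braket_comm, braket_coe]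

theorem MatrixAnsatz.braket_mPow (h : MatrixAnsatz q D E W V) (hfin : FiniteSums D E W V)
    (y : R) (n : ℕ) :
    braket W (mulCol (mPow (y • D + E) n) V)
      = normalCoeffs q ((y • genD q + genE q) ^ n) (0, 0) := by
  rcases hfin with ⟨hD, hE, hW⟩ | ⟨hD, hE, hV⟩
  · obtain ⟨d, rfl⟩ := hD.exists_rowMatrix_eq
    obtain ⟨e, rfl⟩ := hE.exists_rowMatrix_eq
    exact braket_mPow_of_row (w := Finsupp.ofSupportFinite W hW) h y n
  · obtain ⟨d, hd⟩ := RowFinite.exists_rowMatrix_eq (A := D.transpose) hD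
    obtain ⟨e, he⟩ := RowFinite.exists_rowMatrix_eq (A := E.transpose) hE
    exact braket_mPow_of_col (v := Finsupp.ofSupportFinite V hV) h hd he y n

end MatrixToOperator

section QWeyl

variable {R : Type u} [CommRing R] {q : R}

theorem ansatz_relation_of_qWeyl {A : Type*} [Ring A] [Algebra R A] {X δ : A}
    (h : δ * X = q • (X * δ) + 1) :
    (δ * (X * (1 + δ)) - 1) * (X * (1 + δ)) - q • (X * (1 + δ) * (δ * (X * (1 + δ)) - 1))
      = 1 + q • (X * (1 + δ)) + (δ * (X * (1 + δ)) - 1) := by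
  have hcomm : X * δ * (1 + δ) = X * (1 + δ) * δ := by noncomm_ring
  rw [ansatz_relation_iff]
  generalize hE : X * (1 + δ) = E at hcomm
  have hδE : δ * E = q • (E * δ) + (1 + δ) := by
    rw [← hE, ← mul_assoc, h, add_mul, one_mul, smul_mul_assoc, hcomm, hE]
  calc (δ * E - 1) * E = (q • (E * δ) + δ) * E := by rw [hδE]; congr 1; abel
    _ = (q • E + 1) * (δ * E - 1 + 1) := by
      rw [sub_add_cancel, ← smul_mul_assoc, add_mul, add_mul, one_mul, mul_assoc]

theorem operatorAnsatz_of_qWeyl {M : Type*} [AddCommGroup M] [Module R M]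
    {X δ : Module.End R M} {W : Module.Dual R M} {V : M} (h : δ * X = q • (X * δ) + 1)
    (hW : W ∘ₗ X = 0) (hV : δ V = 0) (hWV : W V = 1) :
    OperatorAnsatz q (δ * (X * (1 + δ)) - 1) (X * (1 + δ)) W V where
  comm := ansatz_relation_of_qWeyl h
  left := by rw [Module.End.mul_eq_comp, ← LinearMap.comp_assoc, hW, LinearMap.zero_comp]
  right := by simpa [hV, sub_eq_zero] using LinearMap.congr_fun h V
  norm := hWV

/-- The `q`-analogue `1 + q + ⋯ + q ^ (h - 1)` of the number `h`. -/
def qNat (q : R) (h : ℕ) : R := ∑ t ∈ Finset.range h, q ^ t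

theorem qNat_zero (q : R) : qNat q 0 = 0 := rfl

theorem qNat_succ (q : R) (h : ℕ) : qNat q (h + 1) = q * qNat q h + 1 :=
  geom_sum_succ

theorem sum_pow_card_filter_lt {α : Type*} [LinearOrder α] (q : R) (U : Finset α) :
    ∑ i ∈ U, q ^ (U.filter (i < ·)).card = qNat q U.card := by
  induction U using Finset.induction_on_max with
  | empty => rfl
  | insert a s ha ih =>
    have has : a ∉ s := fun h => lt_irrefl a (ha a h)
    have hmax : (insert a s).filter (a < ·) = ∅ := by
      simpa [Finset.filter_eq_empty_iff] using fun j hj => (ha j hj).le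
    have hrest (i : α) (hi : i ∈ s) :
        q ^ ((insert a s).filter (i < ·)).card = q * q ^ (s.filter (i < ·)).card := by
      rw [Finset.filter_insert, if_pos (ha i hi),
        Finset.card_insert_of_notMem fun h => has (Finset.mem_filter.mp h).1, pow_succ']
    rw [Finset.sum_insert has, hmax, Finset.sum_congr rfl hrest, ← Finset.mul_sum, ih,
      Finset.card_insert_of_notMem has, qNat_succ, Finset.card_empty, pow_zero, add_comm]

variable (R) in
/-- The operator `X` of the `q`-Weyl algebra on the module of polynomials in `X`, where
`single h 1` stands for the monomial `X ^ h`. -/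
noncomputable def mulX : Module.End R (ℕ →₀ R) :=
  Finsupp.lmapDomain R R Nat.succ

/-- The `q`-derivative on the module of polynomials in `X`. -/
noncomputable def qDeriv (q : R) : Module.End R (ℕ →₀ R) :=
  Finsupp.linearCombination R fun h => qNat q h • Finsupp.single (h - 1) 1

theorem mulX_single (h : ℕ) : mulX R (Finsupp.single h 1) = Finsupp.single (h + 1) 1 := by
  simp [mulX, Finsupp.mapDomain_single]

theorem qDeriv_single (q : R) (h : ℕ) :
    qDeriv q (Finsupp.single h 1) = qNat q h • Finsupp.single (h - 1) 1 := by
  simp [qDeriv]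

theorem mulX_qDeriv_single (q : R) (h : ℕ) :
    mulX R (qDeriv q (Finsupp.single h 1)) = qNat q h • Finsupp.single h 1 := by
  rcases h with _ | h
  · simp [qDeriv_single, qNat_zero]
  · rw [qDeriv_single, map_smul, mulX_single, Nat.add_sub_cancel]

theorem qDeriv_mul_mulX (q : R) : qDeriv q * mulX R = q • (mulX R * qDeriv q) + 1 := by
  refine Finsupp.lhom_ext' fun h => LinearMap.ext_ring ?_
  change qDeriv q (mulX R (Finsupp.single h 1))
    = q • mulX R (qDeriv q (Finsupp.single h 1)) + Finsupp.single h 1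
  rw [mulX_single, mulX_qDeriv_single, qDeriv_single, qNat_succ, Nat.add_sub_cancel, add_smul,
    mul_smul, one_smul]

/-- The operator `X (1 + δ)`, which plays the role of `E` on polynomials in `X`. -/
noncomputable def modelE (q : R) : Module.End R (ℕ →₀ R) := mulX R * (1 + qDeriv q)

/-- The operator `δ X (1 + δ) - 1`, which plays the role of `D` on polynomials in `X`. -/
noncomputable def modelD (q : R) : Module.End R (ℕ →₀ R) := qDeriv q * modelE q - 1

theorem operatorAnsatz_model (q : R) :
    OperatorAnsatz q (modelD q) (modelE q) (Finsupp.lapply 0) (Finsupp.single 0 1) := by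
  refine operatorAnsatz_of_qWeyl (qDeriv_mul_mulX q) ?_ ?_ ?_
  · refine Finsupp.lhom_ext' fun h => LinearMap.ext_ring ?_
    change mulX R (Finsupp.single h 1) 0 = 0
    rw [mulX_single, Finsupp.single_eq_of_ne h.succ_ne_zero.symm]
  · rw [qDeriv_single, qNat_zero, zero_smul]
  · exact Finsupp.single_eq_same

theorem modelE_single (q : R) (h : ℕ) :
    modelE q (Finsupp.single h 1) = Finsupp.single (h + 1) 1 + qNat q h • Finsupp.single h 1 := by
  change mulX R (Finsupp.single h 1 + qDeriv q (Finsupp.single h 1)) = _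
  rw [map_add, mulX_single, mulX_qDeriv_single]

end QWeyl

section PairwiseSubsets

variable {α : Type*} {r : α → α → Prop}

open Classical in
/-- The subsets of `b` whose elements are pairwise related by `r`. -/
noncomputable def pairwiseSubsets (r : α → α → Prop) (b : Finset α) : Finset (Finset α) :=
  b.powerset.filter fun S => (S : Set α).Pairwise r

theorem mem_pairwiseSubsets {b S : Finset α} :
    S ∈ pairwiseSubsets r b ↔ S ⊆ b ∧ (S : Set α).Pairwise r := by
  simp [pairwiseSubsets]

variable [DecidableEq α] [Std.Symm r] {A : Type*} [AddCommMonoid A]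

open Classical in
theorem sum_pairwiseSubsets_insert {b : Finset α} {p : α} (hp : p ∉ b) (F : Finset α → A) :
    ∑ S ∈ pairwiseSubsets r (insert p b), F S
      = ∑ S ∈ pairwiseSubsets r b, (F S + if ∀ s ∈ S, r p s then F (insert p S) else 0) := by
  rw [pairwiseSubsets, pairwiseSubsets, Finset.sum_filter, Finset.sum_powerset_insert hp,
    Finset.sum_filter, ← Finset.sum_add_distrib]
  refine Finset.sum_congr rfl fun S hS => ?_
  have hpS : p ∉ (S : Set α) := fun h => hp (Finset.mem_powerset.mp hS h)
  by_cases hpair : (S : Set α).Pairwise r <;>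
    simp [hpair, Set.pairwise_insert_of_symm_of_notMem hpS]

open Classical in
theorem sum_pairwiseSubsets_union {b L : Finset α} (hdisj : Disjoint b L)
    (hL : ∀ p ∈ L, ∀ p' ∈ L, ¬ r p p') (F : Finset α → A) :
    ∑ S ∈ pairwiseSubsets r (b ∪ L), F S
      = ∑ S ∈ pairwiseSubsets r b,
          (F S + ∑ p ∈ L with ∀ s ∈ S, r p s, F (insert p S)) := by
  induction L using Finset.induction_on generalizing F with
  | empty => simp
  | insert a L ha ih =>
    obtain ⟨hab, hdisj⟩ := Finset.disjoint_insert_right.mp hdisj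
    have hunrelated (p : α) (hp : p ∈ L) (S : Finset α) : ¬ ∀ s ∈ insert p S, r a s := fun h =>
      hL a (Finset.mem_insert_self a L) p (Finset.mem_insert_of_mem hp)
        (h p (Finset.mem_insert_self p S))
    have hL' (p : α) (hp : p ∈ L) (p' : α) (hp' : p' ∈ L) : ¬ r p p' :=
      hL p (Finset.mem_insert_of_mem hp) p' (Finset.mem_insert_of_mem hp')
    rw [Finset.union_insert, sum_pairwiseSubsets_insert (by simp [hab, ha]), ih hdisj hL']
    refine Finset.sum_congr rfl fun S _ => ?_
    rw [Finset.sum_filter, Finset.sum_filter, Finset.sum_insert ha, add_assoc]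
    refine congrArg₂ _ rfl (congrArg₂ _ rfl (Finset.sum_congr rfl fun p hp => ?_))
    rw [if_neg (hunrelated p hp S), add_zero]

end PairwiseSubsets

section RookPlacements

/-- Two cells of a chessboard are non-attacking for rooks if they share neither row nor column. -/
def NonAttacking (p p' : ℕ × ℕ) : Prop := p.1 ≠ p'.1 ∧ p.2 ≠ p'.2

instance : Std.Symm NonAttacking := ⟨fun _ _ h => ⟨h.1.symm, h.2.symm⟩⟩

/-- The placements of non-attacking rooks on the cells of the board `b`. They serve as partially
constructed permutations, a rook at `(i, j)` meaning that `i` is sent to `j`. -/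
noncomputable def rookPlacements (b : Finset (ℕ × ℕ)) : Finset (Finset (ℕ × ℕ)) :=
  pairwiseSubsets NonAttacking b

theorem mem_rookPlacements {b S : Finset (ℕ × ℕ)} :
    S ∈ rookPlacements b ↔ S ⊆ b ∧ (S : Set (ℕ × ℕ)).Pairwise NonAttacking :=
  mem_pairwiseSubsets

theorem injOn_fst_of_mem_rookPlacements {b S : Finset (ℕ × ℕ)} (hS : S ∈ rookPlacements b) :
    Set.InjOn Prod.fst (S : Set (ℕ × ℕ)) := fun _ hp _ hp' h =>
  by_contra fun hne => ((mem_rookPlacements.mp hS).2 hp hp' hne).1 h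

theorem injOn_snd_of_mem_rookPlacements {b S : Finset (ℕ × ℕ)} (hS : S ∈ rookPlacements b) :
    Set.InjOn Prod.snd (S : Set (ℕ × ℕ)) := fun _ hp _ hp' h =>
  by_contra fun hne => ((mem_rookPlacements.mp hS).2 hp hp' hne).2 h

variable {A : Type*} [AddCommMonoid A]

theorem sum_rookPlacements_union_row {a : ℕ} {b : Finset (ℕ × ℕ)} (ha : ∀ p ∈ b, p.1 ≠ a)
    (c : Finset ℕ) (F : Finset (ℕ × ℕ) → A) :
    ∑ S ∈ rookPlacements (b ∪ {a} ×ˢ c), F S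
      = ∑ S ∈ rookPlacements b,
          (F S + ∑ j ∈ c \ S.image Prod.snd, F (insert (a, j) S)) := by
  classical
  have hdisj : Disjoint b ({a} ×ˢ c) := Finset.disjoint_left.mpr fun p hp hp' =>
    ha p hp (by simpa using (Finset.mem_product.mp hp').1)
  rw [rookPlacements, sum_pairwiseSubsets_union hdisj (by simp [NonAttacking])]
  refine Finset.sum_congr rfl fun S hS => ?_
  have hrow (s : ℕ × ℕ) (hs : s ∈ S) : s.1 ≠ a := ha s ((mem_rookPlacements.mp hS).1 hs)
  rw [Finset.sum_filter, Finset.sum_product, Finset.sum_singleton, Finset.sdiff_eq_filter,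
    Finset.sum_filter]
  refine congrArg _ (Finset.sum_congr rfl fun j _ => if_congr ?_ rfl rfl)
  simp only [NonAttacking, Finset.mem_image, not_exists, not_and]
  exact forall₂_congr fun s hs => by simp [(hrow s hs).symm, eq_comm]

theorem sum_rookPlacements_union_col {a : ℕ} {b : Finset (ℕ × ℕ)} (ha : ∀ p ∈ b, p.2 ≠ a)
    (c : Finset ℕ) (F : Finset (ℕ × ℕ) → A) :
    ∑ S ∈ rookPlacements (b ∪ c ×ˢ {a}), F S
      = ∑ S ∈ rookPlacements b,
          (F S + ∑ i ∈ c \ S.image Prod.fst, F (insert (i, a) S)) := by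
  classical
  have hdisj : Disjoint b (c ×ˢ {a}) := Finset.disjoint_left.mpr fun p hp hp' =>
    ha p hp (by simpa using (Finset.mem_product.mp hp').2)
  rw [rookPlacements, sum_pairwiseSubsets_union hdisj (by simp [NonAttacking])]
  refine Finset.sum_congr rfl fun S hS => ?_
  have hcol (s : ℕ × ℕ) (hs : s ∈ S) : s.2 ≠ a := ha s ((mem_rookPlacements.mp hS).1 hs)
  rw [Finset.sum_filter, Finset.sum_product_right, Finset.sum_singleton, Finset.sdiff_eq_filter,
    Finset.sum_filter]
  refine congrArg _ (Finset.sum_congr rfl fun i _ => if_congr ?_ rfl rfl)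
  simp only [NonAttacking, Finset.mem_image, not_exists, not_and]
  exact forall₂_congr fun s hs => by simp [(hcol s hs).symm, eq_comm]

end RookPlacements

section Crossings

/-- The number of pairs of a cell `(i, j)` of `S` and an element of `I i j` that is not the row
of a cell of `S` in a column to the left of `j`. Such a row, if empty, is thought of as containing
a cell to the right of `j` that is still to be placed. -/
def crossings (I : ℕ → ℕ → Finset ℕ) (S : Finset (ℕ × ℕ)) : ℕ :=
  ∑ p ∈ S, (I p.1 p.2 \ (S.filter fun s => s.2 < p.2).image Prod.fst).card

theorem crossings_insert_of_snd_lt {I : ℕ → ℕ → Finset ℕ} {S : Finset (ℕ × ℕ)} {j : ℕ} (i : ℕ)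
    (hj : ∀ p ∈ S, p.2 < j) :
    crossings I (insert (i, j) S) = crossings I S + (I i j \ S.image Prod.fst).card := by
  have hmem : (i, j) ∉ S := fun h => lt_irrefl j (hj _ h)
  rw [crossings, Finset.sum_insert hmem, add_comm, crossings]
  congr 1
  · refine Finset.sum_congr rfl fun p hp => ?_
    rw [Finset.filter_insert, if_neg (hj p hp).not_gt]
  · rw [Finset.filter_insert, if_neg (lt_irrefl j), Finset.filter_true_of_mem hj]

theorem crossings_insert_of_notMem {I : ℕ → ℕ → Finset ℕ} {S : Finset (ℕ × ℕ)} {i j : ℕ}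
    (hij : I i j = ∅) (hi : ∀ p ∈ S, i ∉ I p.1 p.2) :
    crossings I (insert (i, j) S) = crossings I S := by
  have hterm (p : ℕ × ℕ) (hp : p ∈ S) :
      I p.1 p.2 \ ((insert (i, j) S).filter fun s => s.2 < p.2).image Prod.fst
        = I p.1 p.2 \ (S.filter fun s => s.2 < p.2).image Prod.fst := by
    rw [Finset.filter_insert]
    split_ifs
    · rw [Finset.image_insert, Finset.sdiff_insert_of_notMem (hi p hp)]
    · rfl
  rw [crossings, crossings]
  by_cases hmem : (i, j) ∈ S
  · rw [Finset.insert_eq_of_mem hmem]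
  · rw [Finset.sum_insert hmem, hij, Finset.empty_sdiff, Finset.card_empty, zero_add]
    exact Finset.sum_congr rfl fun p hp => congrArg _ (hterm p hp)

variable {R : Type u} [CommRing R]

/-- The contribution `y ^ wex * q ^ cr` of a partially constructed permutation: rooks above the
diagonal are weak exceedances, and the two kinds of crossings are counted above the diagonal and,
after transposition, below it. -/
def weight (y q : R) (S : Finset (ℕ × ℕ)) : R :=
  y ^ (S.filter fun p => p.1 < p.2).card
    * q ^ (crossings Finset.Ioc S + crossings Finset.Ioo (S.image Prod.swap))

theorem weight_insert_row (y q : R) {n j : ℕ} {S : Finset (ℕ × ℕ)}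
    (hS : S ⊆ Finset.range n ×ˢ Finset.range n) (hj : j < n) :
    weight y q (insert (n, j) S)
      = weight y q S * q ^ ((Finset.range n \ S.image Prod.snd).filter (j < ·)).card := by
  have hbound (p : ℕ × ℕ) (hp : p ∈ S) : p.1 < n ∧ p.2 < n := by simpa using hS hp
  have hopen : Finset.Ioo j n \ (S.image Prod.swap).image Prod.fst
      = (Finset.range n \ S.image Prod.snd).filter (j < ·) := by
    rw [Finset.image_image]
    ext k
    simp only [Finset.mem_sdiff, Finset.mem_Ioo, Finset.mem_filter, Finset.mem_range]
    exact ⟨fun h => ⟨⟨h.1.2, h.2⟩, h.1.1⟩, fun h => ⟨⟨h.2, h.1.1⟩, h.1.2⟩⟩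
  have hupper : crossings Finset.Ioc (insert (n, j) S) = crossings Finset.Ioc S :=
    crossings_insert_of_notMem (Finset.Ioc_eq_empty_of_le hj.le) fun p hp h =>
      ((Finset.mem_Ioc.mp h).2.trans_lt (hbound p hp).2).false
  have hlower : crossings Finset.Ioo (insert (j, n) (S.image Prod.swap)) = _ :=
    crossings_insert_of_snd_lt j (Finset.forall_mem_image.mpr fun s hs => (hbound s hs).1)
  rw [weight, Finset.filter_insert, if_neg hj.not_gt, Finset.image_insert, Prod.swap_prod_mk,
    hupper, hlower, hopen, ← add_assoc, pow_add, ← mul_assoc, weight]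

theorem weight_insert_col (y q : R) {n i : ℕ} {S : Finset (ℕ × ℕ)}
    (hS : S ⊆ Finset.range (n + 1) ×ˢ Finset.range n) (hi : i < n) :
    weight y q (insert (i, n) S)
      = y * weight y q S
          * q ^ ((Finset.range (n + 1) \ S.image Prod.fst).filter (i < ·)).card := by
  have hbound (p : ℕ × ℕ) (hp : p ∈ S) : p.1 < n + 1 ∧ p.2 < n := by simpa using hS hp
  have hopen : Finset.Ioc i n \ S.image Prod.fst
      = (Finset.range (n + 1) \ S.image Prod.fst).filter (i < ·) := by
    ext k
    simp only [Finset.mem_sdiff, Finset.mem_Ioc, Finset.mem_filter, Finset.mem_range,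
      Nat.lt_succ_iff]
    exact ⟨fun h => ⟨⟨h.1.2, h.2⟩, h.1.1⟩, fun h => ⟨⟨h.2, h.1.1⟩, h.1.2⟩⟩
  have hupper : crossings Finset.Ioc (insert (i, n) S) = _ :=
    crossings_insert_of_snd_lt i fun p hp => (hbound p hp).2
  have hlower : crossings Finset.Ioo (insert (n, i) (S.image Prod.swap))
      = crossings Finset.Ioo (S.image Prod.swap) :=
    crossings_insert_of_notMem (Finset.Ioo_eq_empty_of_le hi.le) <|
      Finset.forall_mem_image.mpr fun s hs h =>
        (hbound s hs).1.not_ge (Nat.succ_le_of_lt (Finset.mem_Ioo.mp h).2)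
  have hmem : (i, n) ∉ S := fun h => lt_irrefl n (hbound _ h).2
  rw [weight, Finset.filter_insert, if_pos hi, Finset.card_insert_of_notMem (by simp [hmem]),
    Finset.image_insert, Prod.swap_prod_mk, hupper, hlower, hopen, weight]
  ring

end Crossings

section StateSum

variable {R : Type u} [CommRing R] (y q : R)

/-- The weighted basis vector of a placement on an `n × n` board, indexed by the number of rows
(equivalently of columns) that are still empty. -/
noncomputable def state (n : ℕ) (S : Finset (ℕ × ℕ)) : ℕ →₀ R :=
  weight y q S • Finsupp.single (n - S.card) 1

/-- The sum of the states of all placements of rooks off the diagonal of an `n × n` board. -/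
noncomputable def stateSum (n : ℕ) : ℕ →₀ R :=
  ∑ S ∈ rookPlacements (Finset.range n).offDiag, state y q n S

theorem card_range_sdiff_image {α : Type*} {S : Finset α} {m : ℕ} {f : α → ℕ}
    (hf : Set.InjOn f (S : Set α)) (hb : ∀ p ∈ S, f p < m) :
    (Finset.range m \ S.image f).card = m - S.card := by
  rw [Finset.card_sdiff_of_subset (Finset.image_subset_iff.mpr fun p hp => by simpa using hb p hp),
    Finset.card_range, Finset.card_image_of_injOn hf]

theorem sum_erase_pow_card_filter_lt {α : Type*} [LinearOrder α] (U : Finset α) {m : α}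
    (hm : ∀ i ∈ U, i ≤ m) :
    ∑ i ∈ U.erase m, q ^ (U.filter (i < ·)).card = qNat q U.card - if m ∈ U then 1 else 0 := by
  rw [← sum_pow_card_filter_lt]
  split_ifs with hmem
  · have hmax : U.filter (m < ·) = ∅ :=
      Finset.filter_eq_empty_iff.mpr fun i hi => (hm i hi).not_gt
    rw [← Finset.sum_erase_add _ _ hmem, hmax, Finset.card_empty, pow_zero, add_sub_cancel_right]
  · rw [Finset.erase_eq_of_notMem hmem, sub_zero]

/-- The board of `Finset.range (n + 1)` without the diagonal and without the last column. -/
def rowExtension (n : ℕ) : Finset (ℕ × ℕ) :=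
  (Finset.range n).offDiag ∪ {n} ×ˢ Finset.range n

theorem offDiag_range_subset (n : ℕ) :
    (Finset.range n).offDiag ⊆ Finset.range n ×ˢ Finset.range n := fun p hp => by
  rw [Finset.mem_offDiag] at hp
  exact Finset.mem_product.mpr ⟨hp.1, hp.2.1⟩

theorem rowExtension_subset (n : ℕ) :
    rowExtension n ⊆ Finset.range (n + 1) ×ˢ Finset.range n :=
  Finset.union_subset
    ((offDiag_range_subset n).trans
      (Finset.product_subset_product_left (Finset.range_mono n.le_succ)))
    (Finset.product_subset_product_left (by simp))

theorem offDiag_range_succ (n : ℕ) :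
    (Finset.range (n + 1)).offDiag = rowExtension n ∪ Finset.range n ×ˢ {n} := by
  rw [Finset.range_add_one, Finset.offDiag_insert Finset.notMem_range_self, rowExtension]

theorem state_add_sum_row {n : ℕ} {S : Finset (ℕ × ℕ)}
    (hS : S ∈ rookPlacements (Finset.range n).offDiag) :
    state y q (n + 1) S
        + ∑ j ∈ Finset.range n \ S.image Prod.snd, state y q (n + 1) (insert (n, j) S)
      = modelE q (state y q n S) := by
  have hsub := (mem_rookPlacements.mp hS).1.trans (offDiag_range_subset n)
  have hbound (p : ℕ × ℕ) (hp : p ∈ S) : p.1 < n ∧ p.2 < n := by simpa using hsub hp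
  have hopen : (Finset.range n \ S.image Prod.snd).card = n - S.card :=
    card_range_sdiff_image (injOn_snd_of_mem_rookPlacements hS) fun p hp => (hbound p hp).2
  have hcard : S.card ≤ n := by
    simpa using Finset.card_le_card_of_injOn Prod.fst
      (fun p hp => Finset.mem_coe.mpr (Finset.mem_range.mpr (hbound p hp).1))
      (injOn_fst_of_mem_rookPlacements hS)
  have hterm (j : ℕ) (hj : j ∈ Finset.range n \ S.image Prod.snd) :
      state y q (n + 1) (insert (n, j) S)
        = q ^ ((Finset.range n \ S.image Prod.snd).filter (j < ·)).card • state y q n S := by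
    have hjn : j < n := Finset.mem_range.mp (Finset.mem_sdiff.mp hj).1
    rw [state, state, weight_insert_row y q hsub hjn,
      Finset.card_insert_of_notMem fun h => lt_irrefl n (hbound _ h).1, Nat.add_sub_add_right,
      smul_smul, mul_comm]
  rw [Finset.sum_congr rfl hterm, ← Finset.sum_smul, sum_pow_card_filter_lt, hopen, state, state,
    map_smul, modelE_single, smul_add, Nat.sub_add_comm hcard, smul_comm]

-- The subtracted term makes up for the missing diagonal cell `(n, n)`.
theorem state_add_sum_col {n : ℕ} {S : Finset (ℕ × ℕ)} (hS : S ∈ rookPlacements (rowExtension n)) :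
    state y q (n + 1) S
        + ∑ i ∈ Finset.range n \ S.image Prod.fst, state y q (n + 1) (insert (i, n) S)
      = (1 + y • qDeriv q) (state y q (n + 1) S)
        - y • if n ∈ S.image Prod.fst then 0 else state y q n S := by
  have hsub := (mem_rookPlacements.mp hS).1.trans (rowExtension_subset n)
  have hbound (p : ℕ × ℕ) (hp : p ∈ S) : p.1 < n + 1 ∧ p.2 < n := by simpa using hsub hp
  set U := Finset.range (n + 1) \ S.image Prod.fst with hU
  have hopen : U.card = n + 1 - S.card :=
    card_range_sdiff_image (injOn_fst_of_mem_rookPlacements hS) fun p hp => (hbound p hp).1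
  have herase : Finset.range n \ S.image Prod.fst = U.erase n := by
    rw [hU, ← Finset.erase_sdiff_comm, Finset.range_add_one,
      Finset.erase_insert Finset.notMem_range_self]
  have hterm (i : ℕ) (hi : i ∈ U.erase n) :
      state y q (n + 1) (insert (i, n) S) = q ^ (U.filter (i < ·)).card • y • state y q n S := by
    have hin : i < n := Finset.mem_range.mp (Finset.mem_sdiff.mp (herase ▸ hi)).1
    rw [state, state, weight_insert_col y q hsub hin,
      Finset.card_insert_of_notMem fun h => lt_irrefl n (hbound _ h).2, Nat.add_sub_add_right,
      smul_smul, smul_smul, mul_comm, mul_assoc]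
  have hderiv : qDeriv q (state y q (n + 1) S) = qNat q U.card • state y q n S := by
    rw [state, map_smul, qDeriv_single, hopen, state, smul_comm, Nat.sub_right_comm,
      Nat.add_sub_cancel]
  have hmem : n ∈ U ↔ n ∉ S.image Prod.fst := by simp [hU]
  rw [herase, Finset.sum_congr rfl hterm, ← Finset.sum_smul,
    sum_erase_pow_card_filter_lt q U fun i hi =>
      Finset.mem_range_succ_iff.mp (Finset.mem_sdiff.mp hi).1,
    LinearMap.add_apply, LinearMap.smul_apply, hderiv, Module.End.one_apply, add_sub_assoc,
    sub_smul, smul_comm]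
  by_cases hn : n ∈ S.image Prod.fst <;> simp [hmem, hn]

theorem sum_state_rowExtension (n : ℕ) :
    ∑ S ∈ rookPlacements (rowExtension n), state y q (n + 1) S = modelE q (stateSum y q n) := by
  rw [rowExtension, sum_rookPlacements_union_row fun p hp h => ?_, stateSum, map_sum]
  · exact Finset.sum_congr rfl fun S hS => state_add_sum_row y q hS
  · simp [h] at hp

theorem sum_state_rowExtension_of_notMem (n : ℕ) :
    (∑ S ∈ rookPlacements (rowExtension n), if n ∈ S.image Prod.fst then 0 else state y q n S)
      = stateSum y q n := by
  have hrow (p : ℕ × ℕ) (hp : p ∈ (Finset.range n).offDiag) : p.1 ≠ n :=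
    (Finset.mem_range.mp (Finset.mem_offDiag.mp hp).1).ne
  rw [rowExtension, sum_rookPlacements_union_row hrow, stateSum]
  refine Finset.sum_congr rfl fun S hS => ?_
  have hnS : n ∉ S.image Prod.fst := fun h => by
    obtain ⟨p, hp, hpn⟩ := Finset.mem_image.mp h
    exact hrow p ((mem_rookPlacements.mp hS).1 hp) hpn
  simp [hnS]

theorem stateSum_zero : stateSum y q 0 = Finsupp.single 0 1 := by
  have hempty : rookPlacements (Finset.range 0).offDiag = {∅} := by
    ext S
    rw [mem_rookPlacements, Finset.range_zero, Finset.offDiag_empty, Finset.subset_empty,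
      Finset.mem_singleton]
    exact ⟨And.left, fun h => ⟨h, by simp [h]⟩⟩
  rw [stateSum, hempty, Finset.sum_singleton]
  simp [state, weight, crossings]

theorem stateSum_succ (n : ℕ) :
    stateSum y q (n + 1) = (y • modelD q + modelE q) (stateSum y q n) := by
  have hcol (p : ℕ × ℕ) (hp : p ∈ rowExtension n) : p.2 ≠ n :=
    (Finset.mem_range.mp (Finset.mem_product.mp (rowExtension_subset n hp)).2).ne
  calc stateSum y q (n + 1)
      = ∑ S ∈ rookPlacements (rowExtension n), ((1 + y • qDeriv q) (state y q (n + 1) S)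
          - y • if n ∈ S.image Prod.fst then 0 else state y q n S) := by
        rw [stateSum, offDiag_range_succ, sum_rookPlacements_union_col hcol]
        exact Finset.sum_congr rfl fun S hS => state_add_sum_col y q hS
    _ = (1 + y • qDeriv q) (modelE q (stateSum y q n)) - y • stateSum y q n := by
        rw [Finset.sum_sub_distrib, ← map_sum, sum_state_rowExtension, ← Finset.smul_sum,
          sum_state_rowExtension_of_notMem]
    _ = (y • modelD q + modelE q) (stateSum y q n) := by
        simp only [modelD, LinearMap.add_apply, LinearMap.smul_apply, LinearMap.sub_apply,
          Module.End.one_apply, Module.End.mul_apply, smul_sub]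
        abel

theorem stateSum_eq_pow (n : ℕ) :
    stateSum y q n = ((y • modelD q + modelE q) ^ n) (Finsupp.single 0 1) := by
  induction n with
  | zero => exact stateSum_zero y q
  | succ n ih => rw [stateSum_succ, ih, pow_succ', Module.End.mul_apply]

end StateSum

section Graph

variable {n : ℕ}

/-- The graph of a permutation, as a placement of rooks on an `n × n` board. -/
def graph (σ : Equiv.Perm (Fin n)) : Finset (ℕ × ℕ) :=
  Finset.univ.image fun i : Fin n => ((i : ℕ), (σ i : ℕ))

theorem mem_graph {σ : Equiv.Perm (Fin n)} {p : ℕ × ℕ} :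
    p ∈ graph σ ↔ ∃ i : Fin n, ((i : ℕ), (σ i : ℕ)) = p := by
  simp [graph]

theorem injective_val_prod (σ : Equiv.Perm (Fin n)) :
    Function.Injective fun i : Fin n => ((i : ℕ), (σ i : ℕ)) := fun _ _ h =>
  Fin.ext (Prod.mk.inj h).1

theorem graph_injective : Function.Injective (graph : Equiv.Perm (Fin n) → _) := by
  intro σ τ h
  ext i
  obtain ⟨j, hj⟩ := mem_graph.mp (h ▸ mem_graph.mpr ⟨i, rfl⟩ : ((i : ℕ), (σ i : ℕ)) ∈ graph τ)
  rw [Prod.mk.injEq] at hj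
  rw [← hj.2, Fin.ext hj.1]

theorem card_graph (σ : Equiv.Perm (Fin n)) : (graph σ).card = n := by
  rw [graph, Finset.card_image_of_injective _ (injective_val_prod σ), Finset.card_univ,
    Fintype.card_fin]

theorem image_swap_graph (σ : Equiv.Perm (Fin n)) : (graph σ).image Prod.swap = graph σ⁻¹ := by
  rw [graph, Finset.image_image, ← Finset.image_univ_equiv σ⁻¹, Finset.image_image, graph]
  refine Finset.image_congr fun i _ => ?_
  simp

theorem graph_mem_rookPlacements {σ : Equiv.Perm (Fin n)} (hσ : σ ∈ derangements (Fin n)) :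
    graph σ ∈ rookPlacements (Finset.range n).offDiag := by
  refine mem_rookPlacements.mpr ⟨fun p hp => ?_, fun p hp p' hp' hne => ?_⟩
  · obtain ⟨i, rfl⟩ := mem_graph.mp hp
    simpa [eq_comm, Fin.val_inj] using hσ i
  · obtain ⟨i, rfl⟩ := mem_graph.mp hp
    obtain ⟨j, rfl⟩ := mem_graph.mp hp'
    have hij : i ≠ j := fun h => hne (by rw [h])
    exact ⟨Fin.val_injective.ne hij, Fin.val_injective.ne (σ.injective.ne hij)⟩

theorem exists_graph_eq {S : Finset (ℕ × ℕ)} (hS : S ∈ rookPlacements (Finset.range n).offDiag)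
    (hcard : n ≤ S.card) : ∃ σ ∈ derangements (Fin n), graph σ = S := by
  have hbound (p : ℕ × ℕ) (hp : p ∈ S) : p.1 < n ∧ p.2 < n ∧ p.1 ≠ p.2 := by
    simpa using (mem_rookPlacements.mp hS).1 hp
  have hrows : S.image Prod.fst = Finset.range n :=
    Finset.eq_of_subset_of_card_le
      (Finset.image_subset_iff.mpr fun p hp => Finset.mem_range.mpr (hbound p hp).1)
      (by rwa [Finset.card_range, Finset.card_image_of_injOn (injOn_fst_of_mem_rookPlacements hS)])
  have hex (i : Fin n) : ∃ j : Fin n, ((i : ℕ), (j : ℕ)) ∈ S := by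
    obtain ⟨p, hp, hpi⟩ := Finset.mem_image.mp (hrows ▸ Finset.mem_range.mpr i.2)
    exact ⟨⟨p.2, (hbound p hp).2.1⟩, hpi ▸ hp⟩
  choose f hf using hex
  have hinj : Function.Injective f := fun i j h =>
    Fin.ext (Prod.mk.inj (injOn_snd_of_mem_rookPlacements hS (hf i) (hf j) (by rw [h]))).1
  let σ := Equiv.ofBijective f (Finite.injective_iff_bijective.mp hinj)
  have hsub : graph σ ⊆ S := fun p hp => by
    obtain ⟨i, rfl⟩ := mem_graph.mp hp
    exact hf i
  have hcard_le : S.card ≤ (graph σ).card := by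
    rw [card_graph, ← Finset.card_image_of_injOn (injOn_fst_of_mem_rookPlacements hS), hrows,
      Finset.card_range]
  exact ⟨σ, fun i h => (hbound _ (hf i)).2.2 (congrArg Fin.val h.symm),
    Finset.eq_of_subset_of_card_le hsub hcard_le⟩

theorem card_filter_graph {σ : Equiv.Perm (Fin n)} (hσ : σ ∈ derangements (Fin n)) :
    ((graph σ).filter fun p => p.1 < p.2).card = wex σ := by
  rw [graph, Finset.filter_image, Finset.card_image_of_injective _ (injective_val_prod σ), wex]
  exact congrArg _ (Finset.filter_congr fun i _ => (lt_iff_le_and_ne.trans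
    (and_iff_left (hσ i).symm) : i < σ i ↔ i ≤ σ i))

theorem crossings_graph {I : ℕ → ℕ → Finset ℕ} (σ : Equiv.Perm (Fin n))
    (hI : ∀ i : Fin n, I i (σ i) ⊆ Finset.range n) :
    crossings I (graph σ) = (Finset.univ.filter fun p : Fin n × Fin n =>
      (p.2 : ℕ) ∈ I p.1 (σ p.1) ∧ σ p.1 ≤ σ p.2).card := by
  have hleft (i j : Fin n) :
      (j : ℕ) ∈ ((graph σ).filter fun s => s.2 < (σ i : ℕ)).image Prod.fst ↔ σ j < σ i := by
    simp [graph, Fin.val_inj]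
  rw [crossings, graph, Finset.sum_image (injective_val_prod σ).injOn, ← graph,
    Finset.card_filter, ← Finset.univ_product_univ, Finset.sum_product]
  refine Finset.sum_congr rfl fun i _ => ?_
  rw [← Finset.card_filter, ← Finset.card_map Fin.valEmbedding]
  congr 1
  ext k
  simp only [Finset.mem_sdiff, Finset.mem_map, Finset.mem_filter, Finset.mem_univ, true_and,
    Fin.valEmbedding_apply]
  constructor
  · rintro ⟨hk, hleft_k⟩
    have hkn : k < n := Finset.mem_range.mp (hI i hk)
    exact ⟨⟨k, hkn⟩, ⟨hk, not_lt.mp fun h => hleft_k ((hleft i ⟨k, hkn⟩).mpr h)⟩, rfl⟩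
  · rintro ⟨j, ⟨hj, hle⟩, rfl⟩
    exact ⟨hj, fun h => ((hleft i j).mp h).not_ge hle⟩

theorem crossings_Ioc_graph (σ : Equiv.Perm (Fin n)) :
    crossings Finset.Ioc (graph σ) = (Finset.univ.filter fun p : Fin n × Fin n =>
      p.1 < p.2 ∧ p.2 ≤ σ p.1 ∧ σ p.1 < σ p.2).card := by
  rw [crossings_graph σ fun i k hk =>
    Finset.mem_range.mpr ((Finset.mem_Ioc.mp hk).2.trans_lt (σ i).2)]
  refine congrArg _ (Finset.filter_congr fun p _ => ?_)
  rw [Finset.mem_Ioc, Fin.val_fin_lt, Fin.val_fin_le, and_assoc]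
  exact and_congr_right fun h => and_congr_right fun _ =>
    (lt_iff_le_and_ne.trans (and_iff_left (σ.injective.ne h.ne))).symm

theorem crossings_Ioo_image_swap_graph (σ : Equiv.Perm (Fin n)) :
    crossings Finset.Ioo ((graph σ).image Prod.swap)
      = (Finset.univ.filter fun p : Fin n × Fin n =>
          σ p.1 < σ p.2 ∧ σ p.2 < p.1 ∧ p.1 < p.2).card := by
  rw [image_swap_graph, crossings_graph σ⁻¹ fun i k hk =>
    Finset.mem_range.mpr ((Finset.mem_Ioo.mp hk).2.trans (σ⁻¹ i).2)]
  refine (Finset.card_equiv (σ.prodCongr σ) fun p => ?_).symm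
  simp only [Finset.mem_filter, Finset.mem_univ, true_and, Equiv.prodCongr_apply, Prod.map_fst,
    Prod.map_snd, Equiv.Perm.inv_def, Equiv.symm_apply_apply, Finset.mem_Ioo, Fin.val_fin_lt,
    and_assoc]
  exact and_congr_right fun h => and_congr_right fun _ =>
    lt_iff_le_and_ne.trans (and_iff_left fun he => h.ne (congrArg σ he))

theorem crossings_graph_add (σ : Equiv.Perm (Fin n)) :
    crossings Finset.Ioc (graph σ) + crossings Finset.Ioo ((graph σ).image Prod.swap) = cr σ := by
  rw [crossings_Ioc_graph, crossings_Ioo_image_swap_graph, cr, Finset.filter_or,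
    Finset.card_union_of_disjoint]
  refine Finset.disjoint_filter.mpr fun p _ hupper hlower => ?_
  exact (hupper.1.trans_le hupper.2.1).not_gt (hlower.1.trans hlower.2.1)

variable {R : Type u} [CommRing R]

theorem weight_graph (y q : R) {σ : Equiv.Perm (Fin n)} (hσ : σ ∈ derangements (Fin n)) :
    weight y q (graph σ) = y ^ wex σ * q ^ cr σ := by
  rw [weight, card_filter_graph hσ, crossings_graph_add]

theorem stateSum_apply_zero (y q : R) (n : ℕ) : stateSum y q n 0 = B n y q := by
  have hcoeff (S : Finset (ℕ × ℕ)) :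
      state y q n S 0 = if n ≤ S.card then weight y q S else 0 := by
    simp [state, Finsupp.single_apply, Nat.sub_eq_zero_iff_le]
  rw [stateSum, Finsupp.finsetSum_apply, Finset.sum_congr rfl fun S _ => hcoeff S,
    ← Finset.sum_filter, B]
  symm
  refine Finset.sum_nbij (fun σ => graph σ.1) (fun σ _ => ?_)
    (fun σ _ τ _ h => Subtype.ext (graph_injective h)) (fun S hS => ?_)
    fun σ _ => (weight_graph y q σ.2).symm
  · exact Finset.mem_filter.mpr ⟨graph_mem_rookPlacements σ.2, (card_graph σ.1).ge⟩
  · obtain ⟨hS, hcard⟩ := Finset.mem_filter.mp hS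
    obtain ⟨σ, hσ, rfl⟩ := exists_graph_eq hS hcard
    exact ⟨⟨σ, hσ⟩, Finset.mem_coe.mpr (Finset.mem_univ _), rfl⟩

end Graph

section ConstantTerm

variable {R : Type u} [CommRing R] {q : R}

theorem normalCoeffs_pow_apply_zero (y q : R) (n : ℕ) :
    normalCoeffs q ((y • genD q + genE q) ^ n) (0, 0) = B n y q := by
  rw [← (operatorAnsatz_model q).apply_rep, rep_pow, ← stateSum_eq_pow]
  exact stateSum_apply_zero y q n

theorem OperatorAnsatz.apply_pow {M : Type w} [AddCommGroup M] [Module R M]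
    {D E : Module.End R M} {W : Module.Dual R M} {V : M} (h : OperatorAnsatz q D E W V)
    (y : R) (n : ℕ) : W (((y • D + E) ^ n) V) = B n y q := by
  rw [← normalCoeffs_pow_apply_zero, ← h.apply_rep, rep_pow]

end ConstantTerm

end DerangementAnsatz

theorem mainTheorem5 {R : Type u} [CommRing R] (y q : R) (n : ℕ) :
    (∀ (ι : Type v) [DecidableEq ι] (D E : Matrix ι ι R) (W V : ι → R),
      FiniteSums D E W V → MatrixAnsatz q D E W V →
        braket W (mulCol (mPow (y • D + E) n) V) = B n y q) ∧
    (∀ (M : Type w) [AddCommGroup M] [Module R M]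
      (D E : Module.End R M) (W : Module.Dual R M) (V : M),
      OperatorAnsatz q D E W V → W (((y • D + E) ^ n) V) = B n y q) ∧
    (∃! c : ℕ × ℕ →₀ R, IsNormalOrder q ((y • genD q + genE q) ^ n) c) ∧
    (∀ c : ℕ × ℕ →₀ R, IsNormalOrder q ((y • genD q + genE q) ^ n) c → c (0, 0) = B n y q) := by
  refine ⟨fun ι _ D E W V hfin h => ?matrices, fun M _ _ D E W V h => h.apply_pow y n,
    existsUnique_isNormalOrder _, fun c hc => ?constant_term⟩
  case matrices => rw [h.braket_mPow hfin y n, normalCoeffs_pow_apply_zero]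
  case constant_term => rw [isNormalOrder_iff.mp hc, normalCoeffs_pow_apply_zero]
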